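/- Let $D$ be a skew field and let $R$ be a ring containing $D$ which is left polynomial over $D$ in $x_1,\dots,x_n\in R$, that is, every $f\in R$ has a unique representation as a finite sum $f=\sum_{\alpha\in\mathbb N^n}c_\alpha x^\alpha$ with $c_\alpha\in D$, where $x^\alpha=x_1^{\alpha_1}\cdots x_n^{\alpha_n}$. Let $\preceq$ be an admissible order on $\mathbb N^n$ (a total order with $0\preceq\alpha$ for all $\alpha$, and $\alpha\preceq\beta\Rightarrow\alpha+\gamma\preceq\beta+\gamma$). Put $\exp f=\max_\preceq\{\alpha: c_\alpha\neq0\}$ for $f\ne 0$ and $\exp 0=-\infty$. Assume that $R$ is a left PBW ring with respect to $\preceq$, i.e. $\exp(fg)=\exp f+\exp g$ for all $f,g\in R$. For $\alpha,\beta\in\mathbb N^n$ let $0\ne q_{\alpha,\beta}\in D$ be the coefficient of $x^{\alpha+\beta}$ in $x^\alpha x^\beta$. Let $R^m$ be the free left $R$-module with canonical basis $e_1,\dots,e_m$. Extend $\preceq$ to an admissible order on $\mathbb N^n\times\{1,\dots,m\}$, i.e. to a total order, again denoted by $\preceq$, such that $(\alpha,i)\preceq(\beta,j)$ implies $(\alpha+\gamma,i)\preceq(\beta+\gamma,j)$,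 and $(\alpha,i)\preceq(\beta,i)$ if and only if $\alpha\preceq\beta$. For $f=\sum c_{(\alpha,i)}x^\alpha e_i\in R^m$ let $\mathcal N(f)=\{(\alpha,i):c_{(\alpha,i)}\neq0\}$ and, if $f\neq0$, let $\exp f=\max_\preceq\mathcal N(f)$ (again $\exp 0=-\infty$); if $\exp f=(\alpha,i)$, then $\alpha$ is the scalar exponent of $f$, $i=\operatorname{level}(f)$ is its level, and $f$ is monic if $c_{(\alpha,i)}=1$. Write $(\alpha,i)+\gamma=(\alpha+\gamma,i)$, with the usual conventions for $-\infty$. Let $G=\{g_1,\dots,g_t\}\subseteq R^m$ be a finite set of monic elements, let $\alpha_i$ be the scalar exponent of $g_i$, and let ${}_R\langle G\rangle$ be the left submodule generated by $G$. The set $G$ is a Gröbner basis of a left submodule $L$ if $G\subseteq L$ and $\{\exp f:0\neq f\in L\}=\bigcup_{i=1}^t(\exp g_i+\mathbb N^n)$. An element $r\in R^m$ is a remainder of the division of $f\in R^m$ by $G$ if there are $h_1,\dots,h_t\in R$ with $f=\sum_i h_ig_i+r$, with $r=0$ or $\mathcal N(r)\cap\bigcup_i(\exp g_i+\mathbb N^n)=\emptyset$,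 and with $\max_\preceq\{\exp h_1+\exp g_1,\dots,\exp h_t+\exp g_t,\exp r\}=\exp f$. For $i\neq j$ with $\operatorname{level}(g_i)=\operatorname{level}(g_j)$ put $$SP(g_i,g_j)=r_{ij}g_i-r_{ji}g_j,\qquad r_{ij}=q_{\alpha_i\vee\alpha_j-\alpha_i,\,\alpha_i}^{-1}\,x^{\alpha_i\vee\alpha_j-\alpha_i},$$ where $\vee$ is the componentwise maximum. **Theorem (Buchberger).** The following are equivalent: 1. $G$ is a Gröbner basis of ${}_R\langle G\rangle$; 2. for all $1\le i<j\le t$ with $\operatorname{level}(g_i)=\operatorname{level}(g_j)$, $0$ is a remainder of the division of $SP(g_i,g_j)$ by $G$; 3. for all $1\le i<j\le t$ with $\operatorname{level}(g_i)=\operatorname{level}(g_j)$, every remainder of the division of $SP(g_i,g_j)$ by $G$ is $0$. -/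

import Mathlib

namespace LeftPBW

/-- `le` is a total order on `E`. -/
structure IsTotalOrder {E : Type*} (le : E → E → Prop) : Prop where
  refl : ∀ a, le a a
  antisymm : ∀ a b, le a b → le b a → a = b
  trans : ∀ a b c, le a b → le b c → le a c
  total : ∀ a b, le a b ∨ le b a

/-- `le` is an admissible order on `ℕⁿ`. -/
structure IsAdmissible {n : ℕ} (le : (Fin n → ℕ) → (Fin n → ℕ) → Prop) : Prop where
  totalOrder : IsTotalOrder le
  zero_le : ∀ α, le 0 α
  add_le_add : ∀ α β γ, le α β → le (α + γ) (β + γ)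

/-- `leM` is an admissible order on `ℕ^{n,(m)} = ℕⁿ × {1, …, m}` extending the order `le` of `ℕⁿ`:
a total order, compatible with the action of `ℕⁿ`, whose restriction to each level is `le`.
The orders TOP and POT, for example, are of this kind. -/
structure IsAdmissibleExtension {n m : ℕ} (le : (Fin n → ℕ) → (Fin n → ℕ) → Prop)
    (leM : (Fin n → ℕ) × Fin m → (Fin n → ℕ) × Fin m → Prop) : Prop where
  totalOrder : IsTotalOrder leM
  add_le_add : ∀ α β i j γ, leM (α, i) (β, j) → leM (α + γ, i) (β + γ, j)
  extends_le : ∀ α β i, leM (α, i) (β, i) ↔ le α β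

/-- `a` is the maximum of the set `S` with respect to `le`. -/
def IsMaximum {E : Type*} (le : E → E → Prop) (S : Set E) (a : E) : Prop :=
  a ∈ S ∧ ∀ b ∈ S, le b a

/-- The extension of `le` to `E ∪ {-∞}` for which `-∞` is the least element. -/
def leBot {E : Type*} (le : E → E → Prop) (a b : WithBot E) : Prop :=
  ∀ a' : E, a = (a' : WithBot E) → ∃ b' : E, b = (b' : WithBot E) ∧ le a' b'

open Classical in
/-- The maximum of `S` with respect to `le`, and `-∞` if there is none (`S` empty). -/
noncomputable def maxOrBot {E : Type*} (le : E → E → Prop) (S : Set E) : WithBot E :=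
  if h : ∃ a, IsMaximum le S a then (h.choose : WithBot E) else ⊥

/-- The standard monomial `x^α = x₁^α₁ ⋯ xₙ^αₙ` (the factors in this order). -/
def monomial {R : Type*} [Ring R] {n : ℕ} (x : Fin n → R) (α : Fin n → ℕ) : R :=
  (List.ofFn fun i => x i ^ α i).prod

/-- The structure of a left polynomial ring over the skew field `D` in `x₁, …, xₙ` on the ring `R`:
a copy of `D` in `R`, and elements `x₁, …, xₙ`, such that every element of `R` has a
unique standard representation `∑ c_α x^α` (a finite sum) with coefficients in `D`.
(The map `ι` is injective, since `D` is a skew field and `R` is not the zero ring.) -/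
structure LeftPolynomialRing (D R : Type*) [DivisionRing D] [Ring R] (n : ℕ) where
  ι : D →+* R
  x : Fin n → R
  existsUnique_repr : ∀ f : R, ∃! c : (Fin n → ℕ) →₀ D,
    f = c.sum fun α a => ι a * monomial x α

variable {D R : Type*} [DivisionRing D] [Ring R] {n m t : ℕ}

namespace LeftPolynomialRing

/-- The family of coefficients of the standard representation of `f`. -/
noncomputable def coeff (P : LeftPolynomialRing D R n) (f : R) : (Fin n → ℕ) →₀ D :=
  (P.existsUnique_repr f).choose

/-- The exponent of `f ∈ R`, the largest element of its Newton diagram; `exp 0 = -∞`. -/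
noncomputable def exp (P : LeftPolynomialRing D R n) (le : (Fin n → ℕ) → (Fin n → ℕ) → Prop)
    (f : R) : WithBot (Fin n → ℕ) :=
  maxOrBot le {α | P.coeff f α ≠ 0}

/-- `R` is a left PBW ring with respect to `le`: `exp (fg) = exp f + exp g`. -/
def IsPBW (P : LeftPolynomialRing D R n) (le : (Fin n → ℕ) → (Fin n → ℕ) → Prop) : Prop :=
  ∀ f g : R, P.exp le (f * g) = P.exp le f + P.exp le g

/-- The scalar `q_{α,β}` in `x^α x^β = q_{α,β} x^{α+β} + p_{α,β}`, `exp p_{α,β} ≺ α + β`;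
in other words the coefficient of `x^{α+β}` in `x^α x^β`. -/
noncomputable def q (P : LeftPolynomialRing D R n) (α β : Fin n → ℕ) : D :=
  P.coeff (monomial P.x α * monomial P.x β) (α + β)

/-- The Newton diagram of an element `f` of the free left module `R^m`. -/
def newton (P : LeftPolynomialRing D R n) (f : Fin m → R) : Set ((Fin n → ℕ) × Fin m) :=
  {p | P.coeff (f p.2) p.1 ≠ 0}

/-- The exponent of `f ∈ R^m`; `exp 0 = -∞`. -/
noncomputable def vexp (P : LeftPolynomialRing D R n)
    (leM : (Fin n → ℕ) × Fin m → (Fin n → ℕ) × Fin m → Prop)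
    (f : Fin m → R) : WithBot ((Fin n → ℕ) × Fin m) :=
  maxOrBot leM (P.newton f)

/-- The scalar exponent of a nonzero `f ∈ R^m` (by convention `0` if `f = 0`). -/
noncomputable def sexp (P : LeftPolynomialRing D R n)
    (leM : (Fin n → ℕ) × Fin m → (Fin n → ℕ) × Fin m → Prop) (f : Fin m → R) : Fin n → ℕ :=
  ((P.vexp leM f).map Prod.fst).unbotD 0

/-- The level of a nonzero `f ∈ R^m` (by convention `-∞` if `f = 0`). -/
noncomputable def level (P : LeftPolynomialRing D R n)
    (leM : (Fin n → ℕ) × Fin m → (Fin n → ℕ) × Fin m → Prop) (f : Fin m → R) :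
    WithBot (Fin m) :=
  (P.vexp leM f).map Prod.snd

/-- The leading coefficient of a nonzero `f ∈ R^m` (by convention `0` if `f = 0`). -/
noncomputable def lc (P : LeftPolynomialRing D R n)
    (leM : (Fin n → ℕ) × Fin m → (Fin n → ℕ) × Fin m → Prop) (f : Fin m → R) : D :=
  ((P.vexp leM f).map fun p => P.coeff (f p.2) p.1).unbotD 0

/-- `f ∈ R^m` is monic (in particular nonzero). -/
def IsMonic (P : LeftPolynomialRing D R n)
    (leM : (Fin n → ℕ) × Fin m → (Fin n → ℕ) × Fin m → Prop) (f : Fin m → R) : Prop :=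
  P.lc leM f = 1

end LeftPolynomialRing

/-- The action of `ℕⁿ` on `ℕ^{n,(m)}`, `(α, i) + γ = (α + γ, i)`, extended to `-∞`. -/
def shift (γ : WithBot (Fin n → ℕ)) (p : WithBot ((Fin n → ℕ) × Fin m)) :
    WithBot ((Fin n → ℕ) × Fin m) :=
  WithBot.map₂ (fun γ p => (p.1 + γ, p.2)) γ p

/-- The set `a + ℕⁿ` for `a ∈ ℕ^{n,(m)}` (empty for `a = -∞`). -/
def cone (a : WithBot ((Fin n → ℕ) × Fin m)) : Set ((Fin n → ℕ) × Fin m) :=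
  {p | ∃ γ : Fin n → ℕ, (p : WithBot ((Fin n → ℕ) × Fin m)) = shift (γ : WithBot (Fin n → ℕ)) a}

namespace LeftPolynomialRing

/-- `Exp(L) = {exp f : 0 ≠ f ∈ L}`. -/
def Exp (P : LeftPolynomialRing D R n)
    (leM : (Fin n → ℕ) × Fin m → (Fin n → ℕ) × Fin m → Prop)
    (L : Submodule R (Fin m → R)) : Set ((Fin n → ℕ) × Fin m) :=
  {p | ∃ f ∈ L, f ≠ 0 ∧ P.vexp leM f = (p : WithBot ((Fin n → ℕ) × Fin m))}

/-- `g₁, …, g_t` is a Gröbner basis of the left submodule `L` of `R^m`. -/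
def IsGroebnerBasis (P : LeftPolynomialRing D R n)
    (leM : (Fin n → ℕ) × Fin m → (Fin n → ℕ) × Fin m → Prop)
    (L : Submodule R (Fin m → R)) (g : Fin t → Fin m → R) : Prop :=
  (∀ i, g i ∈ L) ∧ P.Exp leM L = ⋃ i, cone (P.vexp leM (g i))

/-- `r` is a remainder of the division of `f` by `g₁, …, g_t`: it satisfies, together with some
`h₁, …, h_t ∈ R`, the output specification of the division algorithm. -/
def IsRemainder (P : LeftPolynomialRing D R n)
    (le : (Fin n → ℕ) → (Fin n → ℕ) → Prop)
    (leM : (Fin n → ℕ) × Fin m → (Fin n → ℕ) × Fin m → Prop)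
    (f : Fin m → R) (g : Fin t → Fin m → R) (r : Fin m → R) : Prop :=
  ∃ h : Fin t → R,
    f = ∑ i, h i • g i + r ∧
    (r = 0 ∨ P.newton r ∩ (⋃ i, cone (P.vexp leM (g i))) = ∅) ∧
    IsMaximum (leBot leM)
      (insert (P.vexp leM r) (Set.range fun i => shift (P.exp le (h i)) (P.vexp leM (g i))))
      (P.vexp leM f)

/-- The monomial `q_{α ∨ β - α, α}⁻¹ x^{α ∨ β - α}`, where `α`, `β` are the scalar exponents of
`f`, `g` and `α ∨ β` is the componentwise maximum. -/
noncomputable def spMonomial (P : LeftPolynomialRing D R n)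
    (leM : (Fin n → ℕ) × Fin m → (Fin n → ℕ) × Fin m → Prop) (f g : Fin m → R) : R :=
  P.ι (P.q (P.sexp leM f ⊔ P.sexp leM g - P.sexp leM f) (P.sexp leM f))⁻¹ *
    monomial P.x (P.sexp leM f ⊔ P.sexp leM g - P.sexp leM f)

/-- The S-polynomial `SP(f, g)` of monic elements `f`, `g` of the same level. -/
noncomputable def SP (P : LeftPolynomialRing D R n)
    (leM : (Fin n → ℕ) × Fin m → (Fin n → ℕ) × Fin m → Prop) (f g : Fin m → R) : Fin m → R :=
  P.spMonomial leM f g • f - P.spMonomial leM g f • g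

end LeftPolynomialRing

end LeftPBW

/-!
The exponent is multiplicative on `R`, hence also for the action of `R` on `R^m`
(`IsPBW.isMaximum_smul`). Since coefficients lie in a skew field, an element with Newton diagram
below `p` can be reduced strictly below `p` by subtracting a scalar multiple of any element of
exponent `p` (`exists_sub_mem_iio`); scalars need not commute with the variables, but only left
multiples are ever needed.

If every S-polynomial has remainder `0`, consider representations `f = ∑ hᵢ gᵢ` of an element of
the submodule, and call the greatest exponent of a summand the height. The multiples of
S-polynomials show that, modulo sums of height less than `p`, all left multiples of the `gᵢ` with
exponent `p` are proportional over the skew field (`IsPBW.exists_syzygy`,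
`exists_sub_mem_standardSums_iio`). When the height `p` exceeds the exponent of `f`, the
coefficients at `p` cancel, so the factors of proportionality add up to zero and `f` has a
representation of smaller height (`mem_standardSums_iio`). By Dickson's lemma
(`IsAdmissibleExtension.wellFounded`) there is a least height; it equals the exponent of `f`, which
therefore lies in the cone of some `gᵢ`.

Conversely, a remainder of an element of the submodule is in the submodule; if it is nonzero, its
exponent avoids all cones, which is impossible for a Gröbner basis. That one can pass from "every
remainder" to "some remainder" is the existence of the division (`IsPBW.exists_isRemainder`).
-/

namespace LeftPBW

/-! ### Maxima and well-foundedness -/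

section Order

variable {E : Type*} {r : E → E → Prop}

/-- The elements below `a`. -/
def iic (r : E → E → Prop) (a : E) : Set E := {b | r b a}

/-- The elements strictly below `a`. -/
def iio (r : E → E → Prop) (a : E) : Set E := {b | r b a ∧ b ≠ a}

theorem IsTotalOrder.iic_subset_iio (hr : IsTotalOrder r) {a b : E} (h : b ∈ iio r a) :
    iic r b ⊆ iio r a := by
  intro c hc
  refine ⟨hr.trans _ _ _ hc h.1, ?_⟩
  rintro rfl
  exact h.2 (hr.antisymm _ _ h.1 hc)

theorem IsTotalOrder.iic_subset_iic (hr : IsTotalOrder r) {a b : E} (h : r b a) :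
    iic r b ⊆ iic r a := fun _ hc => hr.trans _ _ _ hc h

theorem IsTotalOrder.exists_isMaximum (hr : IsTotalOrder r) {S : Set E} (hS : S.Finite)
    (hne : S.Nonempty) : ∃ a, IsMaximum r S a := by
  induction S, hS using Set.Finite.induction_on with
  | empty => exact absurd hne Set.not_nonempty_empty
  | @insert a S _ _ ih =>
    rcases S.eq_empty_or_nonempty with rfl | hne
    · refine ⟨a, Set.mem_insert _ _, ?_⟩
      rintro b (rfl | hb)
      · exact hr.refl _
      · exact absurd hb (Set.notMem_empty _)
    · obtain ⟨b, hb, hmax⟩ := ih hne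
      rcases hr.total a b with h | h
      · refine ⟨b, Or.inr hb, ?_⟩
        rintro c (rfl | hc)
        exacts [h, hmax c hc]
      · refine ⟨a, Or.inl rfl, ?_⟩
        rintro c (rfl | hc)
        exacts [hr.refl _, hr.trans _ _ _ (hmax c hc) h]

theorem IsTotalOrder.maxOrBot_eq_coe_iff (hr : IsTotalOrder r) {S : Set E} {a : E} :
    maxOrBot r S = (a : WithBot E) ↔ IsMaximum r S a := by
  unfold maxOrBot
  split_ifs with h
  · have hc := h.choose_spec
    rw [WithBot.coe_inj]
    refine ⟨fun e => e ▸ hc, fun ha => ?_⟩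
    exact hr.antisymm _ _ (ha.2 _ hc.1) (hc.2 _ ha.1)
  · exact ⟨fun e => absurd e WithBot.bot_ne_coe, fun ha => absurd ⟨a, ha⟩ h⟩

end Order

variable {D R : Type*} [DivisionRing D] [Ring R] {n m t : ℕ}
  {le : (Fin n → ℕ) → (Fin n → ℕ) → Prop}
  {leM : (Fin n → ℕ) × Fin m → (Fin n → ℕ) × Fin m → Prop}

/-- Dickson's lemma: an admissible order on `ℕⁿ × {1, …, m}` refines the product of the
componentwise order with equality of levels, which is a well-quasi-order. -/
theorem IsAdmissibleExtension.wellFounded (hle : IsAdmissible le)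
    (hM : IsAdmissibleExtension le leM) :
    WellFounded fun p q => leM p q ∧ p ≠ q := by
  have hw : WellQuasiOrdered (fun p q : (Fin n → ℕ) × Fin m => p.1 ≤ q.1 ∧ p.2 = q.2) :=
    WellQuasiOrdered.prod (wellQuasiOrdered_le (α := Fin n → ℕ))
      (Finite.wellQuasiOrdered (fun i j : Fin m => i = j))
  rw [wellFounded_iff_isEmpty_descending_chain]
  refine ⟨fun ⟨f, hf⟩ => ?_⟩
  obtain ⟨i, j, hij, h1, h2⟩ := hw f
  have hdesc : ∀ k, f (i + k + 1) ∈ iio leM (f i) := by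
    intro k
    induction k with
    | zero => exact hf i
    | succ k ih => exact hM.totalOrder.iic_subset_iio ih (hf (i + k + 1)).1
  have hj : f j ∈ iio leM (f i) := by
    have := hdesc (j - i - 1)
    rwa [show i + (j - i - 1) + 1 = j by omega] at this
  have hup : leM (f i) (f j) := by
    have h := hle.add_le_add 0 (f j - f i).1 (f i).1 (hle.zero_le _)
    rw [Prod.fst_sub, tsub_add_cancel_of_le h1, zero_add, ← hM.extends_le _ _ (f j).2] at h
    rwa [show f i = ((f i).1, (f j).2) from Prod.ext rfl h2]
  exact hj.2 (hM.totalOrder.antisymm _ _ hj.1 hup)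

/-! ### Coefficients and exponents in `R` -/

namespace LeftPolynomialRing

variable (P : LeftPolynomialRing D R n)

theorem eq_sum_coeff (f : R) : f = (P.coeff f).sum fun α a => P.ι a * monomial P.x α :=
  (P.existsUnique_repr f).choose_spec.1

theorem coeff_eq {f : R} {c : (Fin n → ℕ) →₀ D}
    (h : f = c.sum fun α a => P.ι a * monomial P.x α) : P.coeff f = c :=
  ((P.existsUnique_repr f).choose_spec.2 c h).symm

theorem coeff_add (f g : R) : P.coeff (f + g) = P.coeff f + P.coeff g := by
  apply P.coeff_eq
  rw [Finsupp.sum_add_index' (by simp) (by simp [add_mul]), ← P.eq_sum_coeff, ← P.eq_sum_coeff]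

theorem coeff_zero : P.coeff 0 = 0 := P.coeff_eq (by simp)

theorem coeff_neg (f : R) : P.coeff (-f) = -P.coeff f := by
  rw [eq_neg_iff_add_eq_zero, ← coeff_add, neg_add_cancel, coeff_zero]

theorem coeff_sub (f g : R) : P.coeff (f - g) = P.coeff f - P.coeff g := by
  rw [sub_eq_add_neg, coeff_add, coeff_neg, sub_eq_add_neg]

theorem coeff_ι_mul (d : D) (f : R) : P.coeff (P.ι d * f) = d • P.coeff f := by
  apply P.coeff_eq
  rw [Finsupp.sum_smul_index (by simp)]
  conv_lhs => rw [P.eq_sum_coeff f, Finsupp.mul_sum]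
  simp [mul_assoc]

theorem coeff_monomial (α : Fin n → ℕ) : P.coeff (monomial P.x α) = Finsupp.single α 1 :=
  P.coeff_eq (by simp)

theorem coeff_eq_zero_iff {f : R} : P.coeff f = 0 ↔ f = 0 :=
  ⟨fun h => by rw [P.eq_sum_coeff f, h, Finsupp.sum_zero_index], fun h => h ▸ P.coeff_zero⟩

/-- The Newton diagram of an element of `R`. -/
def support (f : R) : Set (Fin n → ℕ) := {α | P.coeff f α ≠ 0}

theorem exp_eq_coe_iff (hle : IsAdmissible le) {f : R} {α : Fin n → ℕ} :
    P.exp le f = (α : WithBot (Fin n → ℕ)) ↔ IsMaximum le (P.support f) α :=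
  hle.totalOrder.maxOrBot_eq_coe_iff

theorem exists_isMaximum_support (hle : IsAdmissible le) {f : R} (hf : f ≠ 0) :
    ∃ α, IsMaximum le (P.support f) α := by
  apply hle.totalOrder.exists_isMaximum
  · refine (P.coeff f).support.finite_toSet.subset fun α hα => ?_
    simpa [support] using hα
  · by_contra h
    apply hf
    rw [← P.coeff_eq_zero_iff]
    ext α
    by_contra hα
    exact h ⟨α, hα⟩

theorem isMaximum_support_monomial (hle : IsAdmissible le) (α : Fin n → ℕ) :
    IsMaximum le (P.support (monomial P.x α)) α := by
  have key : ∀ β, β ∈ P.support (monomial P.x α) ↔ α = β := by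
    intro β
    simp [support, coeff_monomial, Finsupp.single_apply, eq_comm]
  exact ⟨(key α).2 rfl, fun β hβ => (key β).1 hβ ▸ hle.totalOrder.refl _⟩

variable {P}

theorem IsPBW.isMaximum_mul (hP : P.IsPBW le) (hle : IsAdmissible le) {f g : R}
    {α β : Fin n → ℕ} (hf : IsMaximum le (P.support f) α) (hg : IsMaximum le (P.support g) β) :
    IsMaximum le (P.support (f * g)) (α + β) := by
  rw [← P.exp_eq_coe_iff hle] at hf hg ⊢
  rw [hP, hf, hg, WithBot.coe_add]

theorem IsPBW.q_ne_zero (hP : P.IsPBW le) (hle : IsAdmissible le) (α β : Fin n → ℕ) :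
    P.q α β ≠ 0 :=
  (hP.isMaximum_mul hle (P.isMaximum_support_monomial hle α)
    (P.isMaximum_support_monomial hle β)).1

variable (P)

theorem isMaximum_ι_mul {d : D} (hd : d ≠ 0) {f : R} {α : Fin n → ℕ}
    (hf : IsMaximum le (P.support f) α) : IsMaximum le (P.support (P.ι d * f)) α := by
  have : P.support (P.ι d * f) = P.support f := by
    ext β
    simp [support, coeff_ι_mul, hd]
  rwa [this]

/-! ### Newton diagrams in the free module -/

/-- The elements of `R^m` whose Newton diagram is contained in `S`. -/
def newtonIn (S : Set ((Fin n → ℕ) × Fin m)) : AddSubgroup (Fin m → R) where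
  carrier := {f | P.newton f ⊆ S}
  zero_mem' := fun p hp => absurd (by simp [coeff_zero]) hp
  add_mem' := by
    intro f g hf hg p hp
    by_contra hS
    have h1 : P.coeff (f p.2) p.1 = 0 := by_contra fun h => hS (hf h)
    have h2 : P.coeff (g p.2) p.1 = 0 := by_contra fun h => hS (hg h)
    exact hp (by simp [coeff_add, h1, h2])
  neg_mem' := by
    intro f hf p hp
    exact hf (by simpa [newton, coeff_neg] using hp)

theorem newtonIn_mono {S T : Set ((Fin n → ℕ) × Fin m)} (h : S ⊆ T) :
    P.newtonIn S ≤ P.newtonIn T := fun _ hf => Set.Subset.trans hf h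

theorem coeff_ι_smul (d : D) (f : Fin m → R) (p : (Fin n → ℕ) × Fin m) :
    P.coeff ((P.ι d • f) p.2) p.1 = d * P.coeff (f p.2) p.1 := by
  simp [coeff_ι_mul]

theorem ι_smul_mem_newtonIn (d : D) {S : Set ((Fin n → ℕ) × Fin m)} {f : Fin m → R}
    (hf : f ∈ P.newtonIn S) : P.ι d • f ∈ P.newtonIn S := by
  intro p hp
  apply hf
  intro h
  exact hp (by rw [coeff_ι_smul, h, mul_zero])

theorem finite_newton (f : Fin m → R) : (P.newton f).Finite := by
  have : P.newton f ⊆ ⋃ l : Fin m, (fun α => (α, l)) '' (P.coeff (f l)).support := by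
    rintro ⟨α, l⟩ hp
    exact Set.mem_iUnion.2 ⟨l, α, by simpa [newton] using hp, rfl⟩
  exact (Set.finite_iUnion fun l => (Finset.finite_toSet _).image _).subset this

theorem eq_zero_of_newton_eq_empty {f : Fin m → R} (h : P.newton f = ∅) : f = 0 := by
  ext l
  rw [Pi.zero_apply, ← P.coeff_eq_zero_iff]
  ext α
  by_contra hα
  exact Set.notMem_empty (α, l) (h ▸ hα)

theorem exists_isMaximum_newton (hM : IsAdmissibleExtension le leM) {f : Fin m → R}
    (hf : f ≠ 0) : ∃ p, IsMaximum leM (P.newton f) p := by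
  exact hM.totalOrder.exists_isMaximum (P.finite_newton f)
    (Set.nonempty_iff_ne_empty.2 fun h => hf (P.eq_zero_of_newton_eq_empty h))

theorem vexp_eq_coe_iff (hM : IsAdmissibleExtension le leM) {f : Fin m → R}
    {p : (Fin n → ℕ) × Fin m} :
    P.vexp leM f = (p : WithBot _) ↔ IsMaximum leM (P.newton f) p :=
  hM.totalOrder.maxOrBot_eq_coe_iff

theorem vexp_zero : P.vexp leM (0 : Fin m → R) = ⊥ := by
  have : ¬ ∃ a, IsMaximum leM (P.newton (0 : Fin m → R)) a := by
    rintro ⟨a, ha, -⟩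
    exact ha (by simp [coeff_zero])
  simp [vexp, maxOrBot, this]

theorem exp_zero : P.exp le 0 = ⊥ := by
  have : ¬ ∃ a, IsMaximum le {α | P.coeff 0 α ≠ 0} a := by
    rintro ⟨a, ha, -⟩
    exact ha (by simp [coeff_zero])
  simp only [exp, maxOrBot, this, dif_neg, not_false_eq_true]

theorem mem_newtonIn_iic {f : Fin m → R} {p : (Fin n → ℕ) × Fin m}
    (hf : IsMaximum leM (P.newton f) p) : f ∈ P.newtonIn (iic leM p) := hf.2

/-- An element with Newton diagram below `p` has `p` as its exponent as soon as `p` occurs. -/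
theorem isMaximum_or_mem_iio {f : Fin m → R} {p : (Fin n → ℕ) × Fin m}
    (hf : f ∈ P.newtonIn (iic leM p)) :
    IsMaximum leM (P.newton f) p ∨ f ∈ P.newtonIn (iio leM p) := by
  by_cases h : p ∈ P.newton f
  · exact Or.inl ⟨h, hf⟩
  · refine Or.inr fun q hq => ⟨hf hq, ?_⟩
    rintro rfl
    exact h hq

theorem mem_newtonIn_iio {f : Fin m → R} {p : (Fin n → ℕ) × Fin m}
    (hf : f ∈ P.newtonIn (iic leM p)) (h : P.coeff (f p.2) p.1 = 0) :
    f ∈ P.newtonIn (iio leM p) :=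
  (P.isMaximum_or_mem_iio hf).resolve_left fun h' => h'.1 h

theorem coeff_eq_zero_of_mem_iio {f : Fin m → R} {p : (Fin n → ℕ) × Fin m}
    (hf : f ∈ P.newtonIn (iio leM p)) : P.coeff (f p.2) p.1 = 0 :=
  by_contra fun h => (hf (show p ∈ P.newton f from h)).2 rfl

/-- Leading terms can be cancelled by left multiples with scalars of the skew field. -/
theorem exists_sub_mem_iio {f u : Fin m → R} {p : (Fin n → ℕ) × Fin m}
    (hf : f ∈ P.newtonIn (iic leM p)) (hu : IsMaximum leM (P.newton u) p) :
    ∃ d : D, f - P.ι d • u ∈ P.newtonIn (iio leM p) := by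
  refine ⟨P.coeff (f p.2) p.1 * (P.coeff (u p.2) p.1)⁻¹, ?_⟩
  apply P.mem_newtonIn_iio
  · exact sub_mem hf (P.ι_smul_mem_newtonIn _ (P.mem_newtonIn_iic hu))
  · rw [Pi.sub_apply, coeff_sub, Finsupp.sub_apply, coeff_ι_smul, mul_assoc,
      inv_mul_cancel₀ hu.1, mul_one, sub_self]

variable {P}

/-- The PBW property passes from `R` to `R^m`. -/
theorem IsPBW.isMaximum_smul (hP : P.IsPBW le) (hle : IsAdmissible le)
    (hM : IsAdmissibleExtension le leM) {u : R} {f : Fin m → R} {γ : Fin n → ℕ}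
    {p : (Fin n → ℕ) × Fin m} (hu : IsMaximum le (P.support u) γ)
    (hf : IsMaximum leM (P.newton f) p) :
    IsMaximum leM (P.newton (u • f)) (p.1 + γ, p.2) := by
  have hfp : IsMaximum le (P.support (f p.2)) p.1 :=
    ⟨hf.1, fun β hβ => (hM.extends_le _ _ p.2).1 (hf.2 (β, p.2) hβ)⟩
  refine ⟨?_, ?_⟩
  · rw [add_comm]
    exact (hP.isMaximum_mul hle hu hfp).1
  · rintro ⟨ζ, l⟩ hζ
    have hl : f l ≠ 0 := by
      intro h0
      exact hζ (by simp [h0, coeff_zero])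
    obtain ⟨β, hβ⟩ := P.exists_isMaximum_support hle hl
    have h1 := (hP.isMaximum_mul hle hu hβ).2 ζ hζ
    rw [add_comm] at h1
    exact hM.totalOrder.trans _ _ _ ((hM.extends_le _ _ l).2 h1)
      (hM.add_le_add _ _ _ _ _ (hf.2 (β, l) hβ.1))

theorem IsPBW.vexp_smul (hP : P.IsPBW le) (hle : IsAdmissible le)
    (hM : IsAdmissibleExtension le leM) (u : R) (f : Fin m → R) :
    P.vexp leM (u • f) = shift (P.exp le u) (P.vexp leM f) := by
  by_cases hu : u = 0
  · rw [hu, zero_smul, vexp_zero, exp_zero]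
    rfl
  by_cases hf : f = 0
  · rw [hf, smul_zero, vexp_zero, shift, WithBot.map₂_bot_right]
  obtain ⟨γ, hγ⟩ := P.exists_isMaximum_support hle hu
  obtain ⟨p, hp⟩ := P.exists_isMaximum_newton hM hf
  rw [(P.exp_eq_coe_iff hle).2 hγ, (P.vexp_eq_coe_iff hM).2 hp]
  exact (P.vexp_eq_coe_iff hM).2 (hP.isMaximum_smul hle hM hγ hp)

theorem IsPBW.smul_mem_iio (hP : P.IsPBW le) (hle : IsAdmissible le)
    (hM : IsAdmissibleExtension le leM) {u : R} {f : Fin m → R} {γ : Fin n → ℕ}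
    {p : (Fin n → ℕ) × Fin m} (hu : IsMaximum le (P.support u) γ)
    (hf : f ∈ P.newtonIn (iio leM p)) :
    u • f ∈ P.newtonIn (iio leM (p.1 + γ, p.2)) := by
  by_cases h0 : f = 0
  · rw [h0, smul_zero]
    exact zero_mem _
  obtain ⟨q, hq⟩ := P.exists_isMaximum_newton hM h0
  obtain ⟨hle1, hne⟩ := hf hq.1
  refine Set.Subset.trans (hP.isMaximum_smul hle hM hu hq).2
    (hM.totalOrder.iic_subset_iio ⟨hM.add_le_add _ _ _ _ _ hle1, fun h => hne ?_⟩)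
  rw [Prod.ext_iff] at h ⊢
  exact ⟨add_right_cancel h.1, h.2⟩

/-- If `f` is monic of exponent `(α, l)`, then `x^γ f` has leading coefficient `q_{γ,α}`. -/
theorem IsPBW.coeff_monomial_smul (hP : P.IsPBW le) (hle : IsAdmissible le)
    (hM : IsAdmissibleExtension le leM) {f : Fin m → R} {p : (Fin n → ℕ) × Fin m}
    (hf : IsMaximum leM (P.newton f) p) (h1 : P.coeff (f p.2) p.1 = 1) (γ : Fin n → ℕ) :
    P.coeff ((monomial P.x γ • f) p.2) (p.1 + γ) = P.q γ p.1 := by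
  have hlow : f - Pi.single p.2 (monomial P.x p.1) ∈ P.newtonIn (iio leM p) := by
    apply P.mem_newtonIn_iio
    · refine sub_mem (P.mem_newtonIn_iic hf) ?_
      rintro ⟨β, l⟩ hβ
      by_cases hl : l = p.2
      · subst hl
        rw [newton, Set.mem_ofPred_eq, Pi.single_eq_same] at hβ
        exact (hM.extends_le _ _ _).2 ((P.isMaximum_support_monomial hle p.1).2 β hβ)
      · exact absurd (by simp [Pi.single_eq_of_ne hl, coeff_zero]) hβ
    · rw [Pi.sub_apply, coeff_sub, Pi.single_eq_same, coeff_monomial, Finsupp.sub_apply, h1,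
        Finsupp.single_eq_same, sub_self]
  have h0 := P.coeff_eq_zero_of_mem_iio
    (hP.smul_mem_iio hle hM (P.isMaximum_support_monomial hle γ) hlow)
  rw [smul_sub, Pi.sub_apply, coeff_sub, Finsupp.sub_apply, sub_eq_zero] at h0
  rw [h0, Pi.smul_apply, Pi.single_eq_same, smul_eq_mul, q, add_comm]

theorem IsMonic.exists_isMaximum (hM : IsAdmissibleExtension le leM) {f : Fin m → R}
    (hf : P.IsMonic leM f) :
    ∃ p, IsMaximum leM (P.newton f) p ∧ P.coeff (f p.2) p.1 = 1 := by
  have h0 : f ≠ 0 := by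
    rintro rfl
    simp [IsMonic, lc, vexp_zero] at hf
  obtain ⟨p, hp⟩ := P.exists_isMaximum_newton hM h0
  refine ⟨p, hp, ?_⟩
  rw [IsMonic, lc, (P.vexp_eq_coe_iff hM).2 hp] at hf
  exact hf

theorem mem_cone_iff {p a : (Fin n → ℕ) × Fin m} :
    p ∈ cone (a : WithBot ((Fin n → ℕ) × Fin m)) ↔ ∃ γ, p = (a.1 + γ, a.2) := by
  simp only [cone, Set.mem_ofPred_eq, shift, WithBot.map₂_coe_coe, WithBot.coe_inj]

/-! ### Standard sums -/

/-- The sums `∑ hᵢ gᵢ` in which each summand has its Newton diagram in `S`. For `S` the set of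
exponents at most `δ`, these are the elements with a representation of height at most `δ`. -/
def standardSums (P : LeftPolynomialRing D R n) (g : Fin t → Fin m → R)
    (S : Set ((Fin n → ℕ) × Fin m)) : AddSubgroup (Fin m → R) where
  carrier := {f | ∃ h : Fin t → R, f = ∑ i, h i • g i ∧ ∀ i, h i • g i ∈ P.newtonIn S}
  zero_mem' := ⟨0, by simp, fun i => by simp [zero_mem]⟩
  add_mem' := by
    rintro _ _ ⟨h, rfl, hh⟩ ⟨k, rfl, hk⟩
    refine ⟨h + k, by simp [add_smul, Finset.sum_add_distrib], fun i => ?_⟩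
    rw [Pi.add_apply, add_smul]
    exact add_mem (hh i) (hk i)
  neg_mem' := by
    rintro _ ⟨h, rfl, hh⟩
    refine ⟨-h, by simp, fun i => ?_⟩
    rw [Pi.neg_apply, neg_smul]
    exact neg_mem (hh i)

variable {g : Fin t → Fin m → R}

theorem standardSums_mono {S T : Set ((Fin n → ℕ) × Fin m)} (h : S ⊆ T) :
    P.standardSums g S ≤ P.standardSums g T := by
  rintro _ ⟨k, rfl, hk⟩
  exact ⟨k, rfl, fun i => P.newtonIn_mono h (hk i)⟩

theorem standardSums_le_newtonIn (S : Set ((Fin n → ℕ) × Fin m)) :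
    P.standardSums g S ≤ P.newtonIn S := by
  rintro _ ⟨k, rfl, hk⟩
  exact sum_mem fun i _ => hk i

theorem mem_standardSums_univ {f : Fin m → R} (hf : f ∈ Submodule.span R (Set.range g)) :
    f ∈ P.standardSums g Set.univ := by
  obtain ⟨h, rfl⟩ := (Submodule.mem_span_range_iff_exists_fun R).1 hf
  exact ⟨h, rfl, fun i => Set.subset_univ _⟩

theorem smul_mem_standardSums {S : Set ((Fin n → ℕ) × Fin m)} (u : R) (i : Fin t)
    (h : u • g i ∈ P.newtonIn S) : u • g i ∈ P.standardSums g S := by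
  refine ⟨Pi.single i u, ?_, fun j => ?_⟩
  · rw [Finset.sum_eq_single i (fun j _ hj => by rw [Pi.single_eq_of_ne hj, zero_smul])
      (fun h => absurd (Finset.mem_univ _) h), Pi.single_eq_same]
  · by_cases hj : j = i
    · subst hj
      rwa [Pi.single_eq_same]
    · rw [Pi.single_eq_of_ne hj, zero_smul]
      exact zero_mem _

theorem ι_smul_mem_standardSums (d : D) {S : Set ((Fin n → ℕ) × Fin m)} {f : Fin m → R}
    (hf : f ∈ P.standardSums g S) : P.ι d • f ∈ P.standardSums g S := by
  obtain ⟨k, rfl, hk⟩ := hf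
  rw [Finset.smul_sum]
  refine sum_mem fun i _ => ?_
  rw [smul_smul]
  refine smul_mem_standardSums _ _ ?_
  rw [← smul_smul]
  exact P.ι_smul_mem_newtonIn _ (hk i)

theorem IsPBW.smul_mem_standardSums_iio (hP : P.IsPBW le) (hle : IsAdmissible le)
    (hM : IsAdmissibleExtension le leM) {u : R} {γ : Fin n → ℕ}
    (hu : IsMaximum le (P.support u) γ) {f : Fin m → R} {p : (Fin n → ℕ) × Fin m}
    (hf : f ∈ P.standardSums g (iio leM p)) :
    u • f ∈ P.standardSums g (iio leM (p.1 + γ, p.2)) := by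
  obtain ⟨k, rfl, hk⟩ := hf
  rw [Finset.smul_sum]
  refine sum_mem fun i _ => ?_
  rw [smul_smul]
  refine smul_mem_standardSums _ _ ?_
  rw [← smul_smul]
  exact hP.smul_mem_iio hle hM hu (hk i)

/-- A nonzero standard sum has a height: the greatest exponent occurring in its summands. -/
theorem exists_mem_standardSums_iic (hM : IsAdmissibleExtension le leM)
    {S : Set ((Fin n → ℕ) × Fin m)} {f : Fin m → R} (hf : f ∈ P.standardSums g S) (h0 : f ≠ 0) :
    ∃ p ∈ S, f ∈ P.standardSums g (iic leM p) := by
  obtain ⟨k, rfl, hk⟩ := hf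
  have hne : (⋃ i, P.newton (k i • g i)).Nonempty := by
    by_contra hempty
    rw [Set.not_nonempty_iff_eq_empty, Set.iUnion_eq_empty] at hempty
    exact h0 (Finset.sum_eq_zero fun i _ => P.eq_zero_of_newton_eq_empty (hempty i))
  obtain ⟨p, hp, hmax⟩ := hM.totalOrder.exists_isMaximum
    (Set.finite_iUnion fun i => P.finite_newton (k i • g i)) hne
  obtain ⟨i, hi⟩ := Set.mem_iUnion.1 hp
  exact ⟨p, hk i hi, k, rfl, fun j q hq => hmax q (Set.mem_iUnion.2 ⟨j, hq⟩)⟩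

/-! ### Division -/

/-- The output of the division algorithm, by well-founded recursion on a bound for the exponent
of the dividend: a leading term in a cone is cancelled, any other one goes to the remainder. -/
theorem IsPBW.exists_reduction (hP : P.IsPBW le) (hle : IsAdmissible le)
    (hM : IsAdmissibleExtension le leM) {a : Fin t → (Fin n → ℕ) × Fin m}
    (ha : ∀ i, IsMaximum leM (P.newton (g i)) (a i)) (p : (Fin n → ℕ) × Fin m)
    (f : Fin m → R) (hf : f ∈ P.newtonIn (iic leM p)) :
    ∃ r ∈ P.newtonIn (iic leM p ∩ (⋃ i, cone (a i : WithBot ((Fin n → ℕ) × Fin m)))ᶜ),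
      f - r ∈ P.standardSums g (iic leM p) := by
  induction p using (hM.wellFounded hle).induction generalizing f with
  | _ p ih =>
  have hlow : ∀ f ∈ P.newtonIn (iio leM p),
      ∃ r ∈ P.newtonIn (iic leM p ∩ (⋃ i, cone (a i : WithBot ((Fin n → ℕ) × Fin m)))ᶜ),
        f - r ∈ P.standardSums g (iic leM p) := by
    intro f hf
    by_cases h0 : f = 0
    · exact ⟨0, zero_mem _, by simp [h0, zero_mem]⟩
    obtain ⟨q, hq⟩ := P.exists_isMaximum_newton hM h0
    have hqp := hf hq.1
    have hsub := hM.totalOrder.iic_subset_iic hqp.1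
    obtain ⟨r, hr, hfr⟩ := ih q hqp f hq.2
    exact ⟨r, P.newtonIn_mono (Set.inter_subset_inter_left _ hsub) hr,
      standardSums_mono hsub hfr⟩
  by_cases hp : p ∈ ⋃ i, cone (a i : WithBot ((Fin n → ℕ) × Fin m))
  · obtain ⟨i, hi⟩ := Set.mem_iUnion.1 hp
    obtain ⟨γ, rfl⟩ := mem_cone_iff.1 hi
    have hu := hP.isMaximum_smul hle hM (P.isMaximum_support_monomial hle γ) (ha i)
    obtain ⟨d, hd⟩ := P.exists_sub_mem_iio hf hu
    obtain ⟨r, hr, hfr⟩ := hlow _ hd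
    refine ⟨r, hr, ?_⟩
    have hg := ι_smul_mem_standardSums d
      (smul_mem_standardSums (monomial P.x γ) i (P.mem_newtonIn_iic hu))
    convert add_mem hfr hg using 1
    abel
  · set l : Fin m → R :=
      Pi.single p.2 (P.ι (P.coeff (f p.2) p.1) * monomial P.x p.1) with hl
    have hlp : ∀ q, P.coeff (l q.2) q.1 = if q = p then P.coeff (f p.2) p.1 else 0 := by
      rintro ⟨β, k⟩
      by_cases hk : k = p.2
      · subst hk
        simp [hl, coeff_ι_mul, coeff_monomial, Finsupp.single_apply, Prod.ext_iff, eq_comm]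
      · simp [hl, coeff_zero, Prod.ext_iff, hk]
    have hlS : l ∈ P.newtonIn {p} := by
      intro q hq
      by_contra hqp
      exact hq (by rw [hlp, if_neg (by simpa using hqp)])
    have hsub : {p} ⊆ iic leM p ∩ (⋃ i, cone (a i : WithBot ((Fin n → ℕ) × Fin m)))ᶜ :=
      Set.singleton_subset_iff.2 ⟨hM.totalOrder.refl p, hp⟩
    have hl' := P.newtonIn_mono hsub hlS
    have hfl : f - l ∈ P.newtonIn (iio leM p) := by
      apply P.mem_newtonIn_iio (sub_mem hf (P.newtonIn_mono Set.inter_subset_left hl'))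
      rw [Pi.sub_apply, coeff_sub, Finsupp.sub_apply, hlp, if_pos rfl, sub_self]
    obtain ⟨r, hr, hfr⟩ := hlow _ hfl
    exact ⟨r + l, add_mem hr hl', by rwa [add_comm, ← sub_sub]⟩

theorem leBot_bot {E : Type*} {r : E → E → Prop} (b : WithBot E) : leBot r ⊥ b :=
  fun _ h => absurd h WithBot.bot_ne_coe

theorem leBot_vexp_iff (hM : IsAdmissibleExtension le leM) {f : Fin m → R}
    {p : (Fin n → ℕ) × Fin m} :
    leBot leM (P.vexp leM f) (p : WithBot _) ↔ f ∈ P.newtonIn (iic leM p) := by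
  by_cases h0 : f = 0
  · rw [h0, vexp_zero]
    exact ⟨fun _ => zero_mem _, fun _ => leBot_bot _⟩
  obtain ⟨q, hq⟩ := P.exists_isMaximum_newton hM h0
  rw [(P.vexp_eq_coe_iff hM).2 hq]
  constructor
  · intro h
    obtain ⟨b, hb, hle⟩ := h q rfl
    rw [← WithBot.coe_inj.1 hb] at hle
    exact P.newtonIn_mono (hM.totalOrder.iic_subset_iic hle) (P.mem_newtonIn_iic hq)
  · rintro h _ he
    exact ⟨p, rfl, WithBot.coe_inj.1 he ▸ h hq.1⟩

theorem IsPBW.exists_isRemainder (hP : P.IsPBW le) (hle : IsAdmissible le)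
    (hM : IsAdmissibleExtension le leM) {a : Fin t → (Fin n → ℕ) × Fin m}
    (ha : ∀ i, IsMaximum leM (P.newton (g i)) (a i)) (f : Fin m → R) :
    ∃ r, P.IsRemainder le leM f g r := by
  have hcone : ∀ i, P.vexp leM (g i) = a i := fun i => (P.vexp_eq_coe_iff hM).2 (ha i)
  by_cases h0 : f = 0
  · subst h0
    refine ⟨0, 0, by simp, Or.inl rfl, ?_⟩
    have : (fun i => shift (P.exp le ((0 : Fin t → R) i)) (P.vexp leM (g i))) = fun _ => ⊥ := by
      ext1 i
      rw [Pi.zero_apply, exp_zero]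
      rfl
    rw [this, vexp_zero]
    refine ⟨Or.inl rfl, ?_⟩
    rintro _ (rfl | ⟨_, rfl⟩) <;> exact leBot_bot _
  obtain ⟨p, hp⟩ := P.exists_isMaximum_newton hM h0
  obtain ⟨r, hr, h, hfr, hh⟩ := hP.exists_reduction hle hM ha p f hp.2
  refine ⟨r, h, by rw [← hfr, sub_add_cancel], Or.inr ?_, ?_, ?_⟩
  · simp_rw [hcone]
    exact Set.eq_empty_of_forall_notMem fun q hq => (hr hq.1).2 hq.2
  · -- If no term had exponent `p`, all of them, and hence `f`, would lie strictly below `p`.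
    rw [(P.vexp_eq_coe_iff hM).2 hp]
    simp_rw [← hP.vexp_smul hle hM]
    by_contra hnot
    rw [Set.mem_insert_iff, Set.mem_range, not_or, not_exists] at hnot
    have hr' : r ∈ P.newtonIn (iio leM p) :=
      (P.isMaximum_or_mem_iio (hr.trans Set.inter_subset_left)).resolve_left
        fun h => hnot.1 ((P.vexp_eq_coe_iff hM).2 h).symm
    have hh' : ∀ i, h i • g i ∈ P.newtonIn (iio leM p) := fun i =>
      (P.isMaximum_or_mem_iio (hh i)).resolve_left
        fun h => hnot.2 i ((P.vexp_eq_coe_iff hM).2 h)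
    have hf : f ∈ P.newtonIn (iio leM p) := by
      rw [← sub_add_cancel f r, hfr]
      exact add_mem (sum_mem fun i _ => hh' i) hr'
    exact (hf hp.1).2 rfl
  · rw [(P.vexp_eq_coe_iff hM).2 hp]
    rintro _ (rfl | ⟨i, rfl⟩)
    · exact (leBot_vexp_iff hM).2 (hr.trans Set.inter_subset_left)
    · simp_rw [← hP.vexp_smul hle hM]
      exact (leBot_vexp_iff hM).2 (hh i)

/-! ### S-polynomials -/

theorem IsPBW.isMaximum_spMonomial_smul (hP : P.IsPBW le) (hle : IsAdmissible le)
    (hM : IsAdmissibleExtension le leM) {f g : Fin m → R} {p q : (Fin n → ℕ) × Fin m}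
    (hf : IsMaximum leM (P.newton f) p) (h1 : P.coeff (f p.2) p.1 = 1)
    (hg : IsMaximum leM (P.newton g) q) :
    IsMaximum leM (P.newton (P.spMonomial leM f g • f)) (p.1 ⊔ q.1, p.2) ∧
      P.coeff ((P.spMonomial leM f g • f) p.2) (p.1 ⊔ q.1) = 1 := by
  have hfe : P.sexp leM f = p.1 := by
    rw [sexp, (P.vexp_eq_coe_iff hM).2 hf]
    rfl
  have hge : P.sexp leM g = q.1 := by
    rw [sexp, (P.vexp_eq_coe_iff hM).2 hg]
    rfl
  have hadd : p.1 + (p.1 ⊔ q.1 - p.1) = p.1 ⊔ q.1 := add_tsub_cancel_of_le le_sup_left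
  have hq := hP.q_ne_zero hle (p.1 ⊔ q.1 - p.1) p.1
  rw [spMonomial, hfe, hge]
  constructor
  · have := hP.isMaximum_smul hle hM (P.isMaximum_ι_mul (inv_ne_zero hq)
      (P.isMaximum_support_monomial hle (p.1 ⊔ q.1 - p.1))) hf
    rwa [hadd] at this
  · have := hP.coeff_monomial_smul hle hM hf h1 (p.1 ⊔ q.1 - p.1)
    rw [hadd] at this
    rw [← smul_smul, P.coeff_ι_smul _ _ (p.1 ⊔ q.1, p.2), this, inv_mul_cancel₀ hq]

theorem IsPBW.SP_mem_iio (hP : P.IsPBW le) (hle : IsAdmissible le)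
    (hM : IsAdmissibleExtension le leM) {f g : Fin m → R} {p q : (Fin n → ℕ) × Fin m}
    (hf : IsMaximum leM (P.newton f) p) (hf1 : P.coeff (f p.2) p.1 = 1)
    (hg : IsMaximum leM (P.newton g) q) (hg1 : P.coeff (g q.2) q.1 = 1) (hpq : p.2 = q.2) :
    P.SP leM f g ∈ P.newtonIn (iio leM (p.1 ⊔ q.1, p.2)) := by
  obtain ⟨h1, h2⟩ := hP.isMaximum_spMonomial_smul hle hM hf hf1 hg
  obtain ⟨h3, h4⟩ := hP.isMaximum_spMonomial_smul hle hM hg hg1 hf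
  rw [sup_comm, ← hpq] at h3 h4
  apply P.mem_newtonIn_iio (sub_mem h1.2 h3.2)
  rw [Pi.sub_apply, coeff_sub, Finsupp.sub_apply, h2, h4, sub_self]

/-- If `0` is a remainder of the S-polynomial of `gᵢ` and `gⱼ`, then every exponent in the cones
of both carries a syzygy of their leading terms that lifts to a sum of smaller height. -/
theorem IsPBW.exists_syzygy (hP : P.IsPBW le) (hle : IsAdmissible le)
    (hM : IsAdmissibleExtension le leM) {a : Fin t → (Fin n → ℕ) × Fin m}
    (ha : ∀ i, IsMaximum leM (P.newton (g i)) (a i))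
    (h1 : ∀ i, P.coeff (g i (a i).2) (a i).1 = 1) {i j : Fin t}
    (hSP : P.IsRemainder le leM (P.SP leM (g i) (g j)) g 0) {p : (Fin n → ℕ) × Fin m}
    (hi : p ∈ cone (a i : WithBot ((Fin n → ℕ) × Fin m)))
    (hj : p ∈ cone (a j : WithBot ((Fin n → ℕ) × Fin m))) :
    ∃ v w : R, IsMaximum leM (P.newton (v • g i)) p ∧ IsMaximum leM (P.newton (w • g j)) p ∧
      v • g i - w • g j ∈ P.standardSums g (iio leM p) := by
  obtain ⟨γ, hγ⟩ := mem_cone_iff.1 hi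
  obtain ⟨γ', hγ'⟩ := mem_cone_iff.1 hj
  have hlev : (a i).2 = (a j).2 := by rw [← congrArg Prod.snd hγ, ← congrArg Prod.snd hγ']
  have hsup : (a i).1 ⊔ (a j).1 ≤ p.1 := by
    refine sup_le ?_ ?_
    · rw [hγ]
      exact le_self_add
    · rw [hγ']
      exact le_self_add
  set ε := p.1 - ((a i).1 ⊔ (a j).1) with hε
  have hp : p = ((a i).1 ⊔ (a j).1 + ε, (a i).2) :=
    Prod.ext (add_tsub_cancel_of_le hsup).symm (by rw [hγ])
  have hmon := P.isMaximum_support_monomial hle ε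
  refine ⟨monomial P.x ε * P.spMonomial leM (g i) (g j),
    monomial P.x ε * P.spMonomial leM (g j) (g i), ?_, ?_, ?_⟩
  · rw [← smul_smul, hp]
    exact hP.isMaximum_smul hle hM hmon
      (hP.isMaximum_spMonomial_smul hle hM (ha i) (h1 i) (ha j)).1
  · rw [← smul_smul, hp, hlev, sup_comm]
    exact hP.isMaximum_smul hle hM hmon
      (hP.isMaximum_spMonomial_smul hle hM (ha j) (h1 j) (ha i)).1
  · rw [← smul_smul, ← smul_smul, ← smul_sub, hp]
    have hlow := hP.SP_mem_iio hle hM (ha i) (h1 i) (ha j) (h1 j) hlev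
    obtain ⟨h, hsum, -, hmax⟩ := hSP
    rw [add_zero] at hsum
    refine hP.smul_mem_standardSums_iio hle hM hmon
      (p := ((a i).1 ⊔ (a j).1, (a i).2)) ⟨h, hsum, fun k => ?_⟩
    have hk := hmax.2 _ (Or.inr ⟨k, rfl⟩)
    simp_rw [← hP.vexp_smul hle hM] at hk
    by_cases h0 : P.SP leM (g i) (g j) = 0
    · rw [h0, vexp_zero] at hk
      by_cases hk0 : h k • g k = 0
      · rw [hk0]
        exact zero_mem _
      · obtain ⟨q, hq⟩ := P.exists_isMaximum_newton hM hk0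
        obtain ⟨b, hb, -⟩ := hk q ((P.vexp_eq_coe_iff hM).2 hq)
        exact absurd hb WithBot.bot_ne_coe
    · obtain ⟨q, hq⟩ := P.exists_isMaximum_newton hM h0
      rw [(P.vexp_eq_coe_iff hM).2 hq, leBot_vexp_iff hM] at hk
      exact hk.trans (hM.totalOrder.iic_subset_iio (hlow hq.1))

/-! ### Buchberger's criterion -/

/-- Modulo standard sums of height less than `p`, all left multiples of the `gᵢ` of exponent `p`
are proportional over the skew field. -/
theorem exists_sub_mem_standardSums_iio {p : (Fin n → ℕ) × Fin m}
    (hsyz : ∀ i j, i ≠ j → (∃ h : R, IsMaximum leM (P.newton (h • g i)) p) →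
      (∃ u : R, IsMaximum leM (P.newton (u • g j)) p) →
      ∃ v w : R, IsMaximum leM (P.newton (v • g i)) p ∧ IsMaximum leM (P.newton (w • g j)) p ∧
        v • g i - w • g j ∈ P.standardSums g (iio leM p))
    {i j : Fin t} {h u : R} (hh : h • g i ∈ P.newtonIn (iic leM p))
    (hu : IsMaximum leM (P.newton (u • g j)) p) :
    ∃ d : D, h • g i - P.ι d • u • g j ∈ P.standardSums g (iio leM p) := by
  have key : ∀ {k : Fin t} {h u : R}, h • g k ∈ P.newtonIn (iic leM p) →
      IsMaximum leM (P.newton (u • g k)) p →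
      ∃ d : D, h • g k - P.ι d • u • g k ∈ P.standardSums g (iio leM p) := by
    intro k h u hh hu
    obtain ⟨d, hd⟩ := P.exists_sub_mem_iio hh hu
    rw [smul_smul, ← sub_smul] at hd
    refine ⟨d, ?_⟩
    rw [smul_smul, ← sub_smul]
    exact smul_mem_standardSums _ _ hd
  rcases P.isMaximum_or_mem_iio hh with hmax | hlow
  · rcases eq_or_ne i j with rfl | hij
    · exact key hh hu
    · obtain ⟨v, w, hv, hw, hvw⟩ := hsyz i j hij ⟨h, hmax⟩ ⟨u, hu⟩
      obtain ⟨c, hc⟩ := key hh hv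
      obtain ⟨d, hd⟩ := key (P.mem_newtonIn_iic hw) hu
      refine ⟨c * d, ?_⟩
      convert add_mem hc (ι_smul_mem_standardSums c (add_mem hvw hd)) using 1
      rw [sub_add_sub_cancel, smul_sub, sub_add_sub_cancel, map_mul, smul_smul (P.ι c)]
  · exact ⟨0, by simpa using smul_mem_standardSums _ _ hlow⟩

/-- The height of a representation can be lowered as long as it exceeds the exponent. -/
theorem mem_standardSums_iio {p : (Fin n → ℕ) × Fin m}
    (hsyz : ∀ i j, i ≠ j → (∃ h : R, IsMaximum leM (P.newton (h • g i)) p) →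
      (∃ u : R, IsMaximum leM (P.newton (u • g j)) p) →
      ∃ v w : R, IsMaximum leM (P.newton (v • g i)) p ∧ IsMaximum leM (P.newton (w • g j)) p ∧
        v • g i - w • g j ∈ P.standardSums g (iio leM p))
    {f : Fin m → R} (hf : f ∈ P.standardSums g (iic leM p)) (hlow : f ∈ P.newtonIn (iio leM p)) :
    f ∈ P.standardSums g (iio leM p) := by
  obtain ⟨h, rfl, hh⟩ := hf
  by_cases hj : ∃ j, IsMaximum leM (P.newton (h j • g j)) p
  · obtain ⟨j, hj⟩ := hj
    choose d hd using fun i => exists_sub_mem_standardSums_iio hsyz (hh i) hj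
    have hsum := sum_mem fun i (_ : i ∈ Finset.univ) => hd i
    rw [Finset.sum_sub_distrib, ← Finset.sum_smul, ← map_sum] at hsum
    -- Comparing coefficients at `p` shows that the multiples of `h j • g j` add up to zero.
    have h0 := P.coeff_eq_zero_of_mem_iio
      (sub_mem hlow (standardSums_le_newtonIn _ hsum))
    rw [sub_sub_cancel, coeff_ι_smul] at h0
    rw [(mul_eq_zero.1 h0).resolve_right hj.1, map_zero, zero_smul, sub_zero] at hsum
    exact hsum
  · rw [not_exists] at hj
    exact ⟨h, rfl, fun i => (P.isMaximum_or_mem_iio (hh i)).resolve_left (hj i)⟩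

theorem IsPBW.mem_cone_of_isMaximum_smul (hP : P.IsPBW le) (hle : IsAdmissible le)
    (hM : IsAdmissibleExtension le leM) {f : Fin m → R} {p a : (Fin n → ℕ) × Fin m}
    (ha : IsMaximum leM (P.newton f) a) {h : R} (hh : IsMaximum leM (P.newton (h • f)) p) :
    p ∈ cone (a : WithBot ((Fin n → ℕ) × Fin m)) := by
  have h0 : h ≠ 0 := by
    rintro rfl
    exact hh.1 (by simp [coeff_zero])
  obtain ⟨γ, hγ⟩ := P.exists_isMaximum_support hle h0
  have := (P.vexp_eq_coe_iff hM).2 (hP.isMaximum_smul hle hM hγ ha)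
  rw [(P.vexp_eq_coe_iff hM).2 hh] at this
  exact mem_cone_iff.2 ⟨γ, WithBot.coe_inj.1 this⟩

theorem IsPBW.isGroebnerBasis_of_isRemainder_zero (hP : P.IsPBW le) (hle : IsAdmissible le)
    (hM : IsAdmissibleExtension le leM) {a : Fin t → (Fin n → ℕ) × Fin m}
    (ha : ∀ i, IsMaximum leM (P.newton (g i)) (a i))
    (h1 : ∀ i, P.coeff (g i (a i).2) (a i).1 = 1)
    (hSP : ∀ i j : Fin t, i < j → (a i).2 = (a j).2 →
      P.IsRemainder le leM (P.SP leM (g i) (g j)) g 0) :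
    P.IsGroebnerBasis leM (Submodule.span R (Set.range g)) g := by
  have hlevel : ∀ {i j p}, p ∈ cone (a i : WithBot ((Fin n → ℕ) × Fin m)) →
      p ∈ cone (a j : WithBot ((Fin n → ℕ) × Fin m)) → (a i).2 = (a j).2 := by
    intro i j p hi hj
    obtain ⟨γ, hγ⟩ := mem_cone_iff.1 hi
    obtain ⟨γ', hγ'⟩ := mem_cone_iff.1 hj
    rw [← congrArg Prod.snd hγ, ← congrArg Prod.snd hγ']
  have hsyz : ∀ p i j, i ≠ j → (∃ h : R, IsMaximum leM (P.newton (h • g i)) p) →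
      (∃ u : R, IsMaximum leM (P.newton (u • g j)) p) →
      ∃ v w : R, IsMaximum leM (P.newton (v • g i)) p ∧ IsMaximum leM (P.newton (w • g j)) p ∧
        v • g i - w • g j ∈ P.standardSums g (iio leM p) := by
    rintro p i j hij ⟨h, hh⟩ ⟨u, hu⟩
    have hi := hP.mem_cone_of_isMaximum_smul hle hM (ha i) hh
    have hj := hP.mem_cone_of_isMaximum_smul hle hM (ha j) hu
    rcases hij.lt_or_gt with hlt | hgt
    · exact hP.exists_syzygy hle hM ha h1 (hSP i j hlt (hlevel hi hj)) hi hj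
    · obtain ⟨v, w, hv, hw, hvw⟩ :=
        hP.exists_syzygy hle hM ha h1 (hSP j i hgt (hlevel hj hi)) hj hi
      exact ⟨w, v, hw, hv, by rw [← neg_sub]; exact neg_mem hvw⟩
  refine ⟨fun i => Submodule.subset_span ⟨i, rfl⟩, Set.Subset.antisymm ?_ ?_⟩
  · rintro q ⟨f, hfL, hf0, hfq⟩
    rw [P.vexp_eq_coe_iff hM] at hfq
    -- Among the heights of the representations of `f`, the least one is the exponent of `f`.
    obtain ⟨p₀, -, hp₀⟩ := exists_mem_standardSums_iic hM (mem_standardSums_univ (P := P) hfL) hf0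
    obtain ⟨p, hp, hmin⟩ := (hM.wellFounded hle).has_min
      {p | f ∈ P.standardSums g (iic leM p)} ⟨p₀, hp₀⟩
    have hnot : f ∉ P.standardSums g (iio leM p) := by
      intro hlt
      obtain ⟨p', hp', hf'⟩ := exists_mem_standardSums_iic hM hlt hf0
      exact hmin p' hf' hp'
    rcases P.isMaximum_or_mem_iio (standardSums_le_newtonIn _ hp) with hmax | hlow
    · obtain rfl : q = p := hM.totalOrder.antisymm _ _ (hmax.2 _ hfq.1) (hfq.2 _ hmax.1)
      obtain ⟨h, rfl, hh⟩ := hp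
      by_contra hq
      refine hnot ⟨h, rfl, fun i => (P.isMaximum_or_mem_iio (hh i)).resolve_left fun hi => hq ?_⟩
      refine Set.mem_iUnion.2 ⟨i, ?_⟩
      rw [(P.vexp_eq_coe_iff hM).2 (ha i)]
      exact hP.mem_cone_of_isMaximum_smul hle hM (ha i) hi
    · exact absurd (mem_standardSums_iio (hsyz p) hp hlow) hnot
  · intro q hq
    obtain ⟨i, hi⟩ := Set.mem_iUnion.1 hq
    rw [(P.vexp_eq_coe_iff hM).2 (ha i)] at hi
    obtain ⟨γ, rfl⟩ := mem_cone_iff.1 hi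
    have hmax := hP.isMaximum_smul hle hM (P.isMaximum_support_monomial hle γ) (ha i)
    refine ⟨monomial P.x γ • g i, Submodule.smul_mem _ _ (Submodule.subset_span ⟨i, rfl⟩), ?_,
      (P.vexp_eq_coe_iff hM).2 hmax⟩
    intro h0
    exact hmax.1 (by rw [h0]; simp [coeff_zero])

/-- An element of `L` has only the remainder `0` upon division by a Gröbner basis of `L`, since
the exponent of any other remainder would lie in one of the cones. -/
theorem IsGroebnerBasis.eq_zero_of_isRemainder (hM : IsAdmissibleExtension le leM)
    {L : Submodule R (Fin m → R)} (hG : P.IsGroebnerBasis leM L g) {f r : Fin m → R}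
    (hf : f ∈ L) (hr : P.IsRemainder le leM f g r) : r = 0 := by
  obtain ⟨h, hsum, hcone, -⟩ := hr
  by_contra h0
  have hrL : r ∈ L := by
    rw [← add_sub_cancel_left (∑ i, h i • g i) r, ← hsum]
    exact sub_mem hf (sum_mem fun i _ => Submodule.smul_mem _ _ (hG.1 i))
  obtain ⟨p, hp⟩ := P.exists_isMaximum_newton hM h0
  have hmem : p ∈ P.Exp leM L := ⟨r, hrL, h0, (P.vexp_eq_coe_iff hM).2 hp⟩
  rw [hG.2] at hmem
  exact Set.notMem_empty p (hcone.resolve_left h0 ▸ ⟨hp.1, hmem⟩)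

theorem SP_mem_span (i j : Fin t) :
    P.SP leM (g i) (g j) ∈ Submodule.span R (Set.range g) :=
  sub_mem (Submodule.smul_mem _ _ (Submodule.subset_span ⟨i, rfl⟩))
    (Submodule.smul_mem _ _ (Submodule.subset_span ⟨j, rfl⟩))

end LeftPolynomialRing

end LeftPBW

/-- Buchberger's theorem over left PBW rings. Remainders are not unique; the equivalence holds
both for "some remainder is zero" and for "every remainder is zero". -/
theorem mainTheorem2 {D R : Type*} [DivisionRing D] [Ring R] {n m t : ℕ}
    (P : LeftPBW.LeftPolynomialRing D R n)
    (le : (Fin n → ℕ) → (Fin n → ℕ) → Prop)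
    (leM : (Fin n → ℕ) × Fin m → (Fin n → ℕ) × Fin m → Prop)
    (hle : LeftPBW.IsAdmissible le)
    (hleM : LeftPBW.IsAdmissibleExtension le leM)
    (hP : P.IsPBW le)
    (g : Fin t → Fin m → R)
    (hg : ∀ i, P.IsMonic leM (g i)) :
    (P.IsGroebnerBasis leM (Submodule.span R (Set.range g)) g ↔
      ∀ i j : Fin t, i < j → P.level leM (g i) = P.level leM (g j) →
        P.IsRemainder le leM (P.SP leM (g i) (g j)) g 0) ∧
    (P.IsGroebnerBasis leM (Submodule.span R (Set.range g)) g ↔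
      ∀ i j : Fin t, i < j → P.level leM (g i) = P.level leM (g j) →
        ∀ r, P.IsRemainder le leM (P.SP leM (g i) (g j)) g r → r = 0) := by
  choose a ha h1 using fun i => (hg i).exists_isMaximum hleM
  have hlevel : ∀ i j, P.level leM (g i) = P.level leM (g j) ↔ (a i).2 = (a j).2 := by
    intro i j
    rw [LeftPBW.LeftPolynomialRing.level, LeftPBW.LeftPolynomialRing.level,
      (P.vexp_eq_coe_iff hleM).2 (ha i), (P.vexp_eq_coe_iff hleM).2 (ha j)]
    exact WithBot.coe_inj
  have h13 : P.IsGroebnerBasis leM (Submodule.span R (Set.range g)) g →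
      ∀ i j : Fin t, i < j → P.level leM (g i) = P.level leM (g j) →
        ∀ r, P.IsRemainder le leM (P.SP leM (g i) (g j)) g r → r = 0 :=
    fun hG i j _ _ r hr => hG.eq_zero_of_isRemainder hleM
      (LeftPBW.LeftPolynomialRing.SP_mem_span i j) hr
  have h32 : (∀ i j : Fin t, i < j → P.level leM (g i) = P.level leM (g j) →
        ∀ r, P.IsRemainder le leM (P.SP leM (g i) (g j)) g r → r = 0) →
      ∀ i j : Fin t, i < j → P.level leM (g i) = P.level leM (g j) →
        P.IsRemainder le leM (P.SP leM (g i) (g j)) g 0 := by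
    intro H i j hij hl
    obtain ⟨r, hr⟩ := hP.exists_isRemainder hle hleM ha (P.SP leM (g i) (g j))
    exact H i j hij hl r hr ▸ hr
  have h21 : (∀ i j : Fin t, i < j → P.level leM (g i) = P.level leM (g j) →
        P.IsRemainder le leM (P.SP leM (g i) (g j)) g 0) →
      P.IsGroebnerBasis leM (Submodule.span R (Set.range g)) g :=
    fun H => hP.isGroebnerBasis_of_isRemainder_zero hle hleM ha h1
      fun i j hij hl => H i j hij ((hlevel i j).2 hl)
  exact ⟨⟨fun hG => h32 (h13 hG), h21⟩, ⟨h13, fun H => h21 (h32 H)⟩⟩
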